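/- Let $G$ be a finite graph without loops, possibly with multiple edges, and let $k\in\{4,5\}$. Suppose that $G$ is $k$-regular, i.e. every vertex of $G$ is incident with exactly $k$ edges, parallel edges being counted with multiplicity. Then $G$ has a maximum matching $M$ (a set of pairwise non-adjacent edges of largest possible cardinality) such that no two distinct vertices that are not incident with any edge of $M$ have a common neighbor. -/

import Mathlib

namespace Graph

/-- The degree of a vertex of a multigraph: the number of edges at `x`, counted with multiplicity
(parallel edges count separately, and a loop counts twice). -/
noncomputable def degree {α β : Type*} (G : Graph α β) (x : α) : ℕ∞ :=
  (G.incidenceSet x).encard + (G.loopSet x).encard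

/-- `G` is `k`-regular: every vertex has degree `k`. -/
def IsRegular {α β : Type*} (G : Graph α β) (k : ℕ) : Prop :=
  ∀ x ∈ G.vertexSet, G.degree x = k

/-- A matching of a (loopless) multigraph: a set of edges, no two of which have a common end.
In particular it contains at most one of several parallel edges. -/
def IsMatching {α β : Type*} (G : Graph α β) (M : Set β) : Prop :=
  M ⊆ G.edgeSet ∧ ∀ e ∈ M, ∀ f ∈ M, e ≠ f → ∀ x, ¬ (G.Inc e x ∧ G.Inc f x)

/-- A matching of maximum cardinality among all matchings of `G`. -/
def IsMaximumMatching {α β : Type*} (G : Graph α β) (M : Set β) : Prop :=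
  G.IsMatching M ∧ ∀ M' : Set β, G.IsMatching M' → M'.encard ≤ M.encard

/-- `x` is a vertex of `G` that is incident with no edge of `M`. -/
def IsUnsaturated {α β : Type*} (G : Graph α β) (M : Set β) (x : α) : Prop :=
  x ∈ G.vertexSet ∧ ∀ e ∈ M, ¬ G.Inc e x

end Graph

/-! The proof rests on a Gallai–Edmonds type structure. The vertex set splits into a set `S` and
disjoint odd factor-critical parts with no edges between different parts, and `S` satisfies Hall's
condition towards the parts. Matching `S` into distinct parts leaves `#P - #S` parts unmatched, each
missing one vertex that may be chosen freely. Berge's bound shows that no matching misses fewer.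
Common neighbors of vertices missed in different parts can only lie in `S`, so the task is to choose
the missed parts and vertices well.

A part having a vertex without neighbors in `S` is harmless: miss that vertex. In any other part
`p`, every vertex sends an edge to `S`. A degree and parity count for `k = 4, 5` (`part_trichotomy`)
shows that either at least `k` edges join `p` to `S`, or `k = 5`, `#p = 3` and each vertex has
exactly one edge to `S`. A weighted Hall argument (`exists_injOn_two_copies`) assigns these parts
injectively to two copies of `S`, parts of the first type using only the first copy. Parts assigned
to the first copy are covered by a matching of all of `S` (`exists_injOn_covering`). A part assigned
to the second copy, if still unmatched, misses its vertex adjacent to the assigned element of `S`.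
That element is the vertex's only neighbor in `S`, and different parts get different elements. -/

open Finset

/-- A selection form of Hall's theorem relative to a finset of indices. -/
theorem Finset.exists_injOn_of_hall {ι κ : Type*} [Nonempty κ] [DecidableEq κ]
    (s : Finset ι) (t : ι → Finset κ)
    (h : ∀ u ⊆ s, #u ≤ #(u.biUnion t)) :
    ∃ f : ι → κ, Set.InjOn f s ∧ ∀ i ∈ s, f i ∈ t i := by
  classical
  obtain ⟨f, hf, hft⟩ := (Finset.all_card_le_biUnion_card_iff_exists_injective
    (fun i : s => t i)).1 (fun u => by
      have := h (u.map (Function.Embedding.subtype _)) (by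
        intro x hx
        obtain ⟨y, -, rfl⟩ := mem_map.1 hx
        exact y.2)
      rw [card_map] at this
      refine this.trans (card_le_card ?_)
      intro x hx
      simp only [mem_biUnion, mem_map] at hx ⊢
      obtain ⟨_, ⟨y, hy, rfl⟩, hx⟩ := hx
      exact ⟨y, hy, hx⟩)
  refine ⟨fun i => if hi : i ∈ s then f ⟨i, hi⟩ else Classical.arbitrary κ, ?_, ?_⟩
  · intro i hi j hj hij
    have hi' : i ∈ s := hi
    have hj' : j ∈ s := hj
    simp only [hi', hj', dif_pos] at hij
    exact congrArg Subtype.val (hf hij)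
  · intro i hi
    simp only [hi, dif_pos]
    exact hft ⟨i, hi⟩

/-! ### Perfectly matched sets -/

open scoped Classical in
/-- `PerfectlyMatched r X`: the finite set `X` can be partitioned into `r`-related pairs. -/
inductive PerfectlyMatched {α : Type*} (r : α → α → Prop) : Finset α → Prop
  | empty : PerfectlyMatched r ∅
  | insert_pair {X : Finset α} {a b : α} (hX : PerfectlyMatched r X) (ha : a ∉ X) (hb : b ∉ X)
      (hne : a ≠ b) (hab : r a b) : PerfectlyMatched r (insert a (insert b X))

namespace PerfectlyMatched

variable {α : Type*} {r : α → α → Prop}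

open scoped Classical in
theorem union {X Y : Finset α} (hX : PerfectlyMatched r X) (hY : PerfectlyMatched r Y)
    (h : Disjoint X Y) : PerfectlyMatched r (X ∪ Y) := by
  induction hX with
  | empty => simpa using hY
  | @insert_pair X a b hX ha hb hne hab ih =>
    simp only [disjoint_insert_left] at h
    rw [insert_union, insert_union]
    refine .insert_pair (ih h.2.2) ?_ ?_ hne hab <;> simp [*]

open scoped Classical in
theorem biUnion {ι : Type*} (s : Finset ι) (f : ι → Finset α)
    (hf : ∀ i ∈ s, PerfectlyMatched r (f i)) (hd : (s : Set ι).PairwiseDisjoint f) :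
    PerfectlyMatched r (s.biUnion f) := by
  induction s using Finset.induction_on with
  | empty => simpa using PerfectlyMatched.empty
  | insert i s hi ih =>
    rw [biUnion_insert]
    refine (hf i (mem_insert_self _ _)).union
      (ih (fun j hj => hf j (mem_insert_of_mem hj)) (hd.subset (by simp))) ?_
    rw [disjoint_biUnion_right]
    intro j hj
    exact hd (by simp) (by simp [hj]) (by rintro rfl; exact hi hj)

end PerfectlyMatched

/-! ### Odd separations and Gallai partitions -/

/-- `S` together with odd sets `P`, each of which is joined only to itself and to `S`. -/
structure IsOddSeparation {α : Type*} (r : α → α → Prop) (W S : Finset α)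
    (P : Finset (Finset α)) : Prop where
  sep_subset : S ⊆ W
  part_subset : ∀ p ∈ P, p ⊆ W
  notMem_sep : ∀ p ∈ P, ∀ x ∈ p, x ∉ S
  odd_card : ∀ p ∈ P, Odd #p
  closed : ∀ p ∈ P, ∀ x ∈ p, ∀ y ∈ W, y ∉ S → r x y → y ∈ p
  eq_of_mem : ∀ p ∈ P, ∀ q ∈ P, ∀ x ∈ p, x ∈ q → p = q

open scoped Classical in
/-- A Gallai partition: an odd separation with factor-critical parts covering the complement of
`S`, in which `S` satisfies Hall's condition with respect to the parts. -/
structure IsGallaiPartition {α : Type*} (r : α → α → Prop) (W S : Finset α)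
    (P : Finset (Finset α)) : Prop extends IsOddSeparation r W S P where
  cover : ∀ x ∈ W, x ∉ S → ∃ p ∈ P, x ∈ p
  factorCritical : ∀ p ∈ P, ∀ c ∈ p, PerfectlyMatched r (p.erase c)
  hall : ∀ T ⊆ S, #T ≤ #{p ∈ P | ∃ s ∈ T, ∃ x ∈ p, r s x}

section

variable {α : Type*} {r : α → α → Prop} {W S : Finset α} {P : Finset (Finset α)}

open scoped Classical in
/-- Matching `S` into distinct parts and omitting one vertex of every other part leaves a perfectly
matched set. -/
theorem IsGallaiPartition.perfectlyMatched (h : IsGallaiPartition r W S P) (f : α → Finset α)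
    (hinj : Set.InjOn f S) (hf : ∀ s ∈ S, f s ∈ P ∧ ∃ x ∈ f s, r s x)
    (c : Finset α → α) (hc : ∀ p ∈ P, p ∉ S.image f → c p ∈ p) :
    PerfectlyMatched r (W \ (P \ S.image f).image c) := by
  choose! hfP x hx hsx using hf
  have key : W \ (P \ S.image f).image c =
      S.biUnion (fun s => insert s (f s)) ∪
        (P \ S.image f).biUnion (fun p => p.erase (c p)) := by
    ext y
    simp only [mem_sdiff, mem_union, mem_biUnion, mem_insert, mem_erase, mem_image, not_exists,
      not_and]
    constructor
    · rintro ⟨hyW, hy⟩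
      by_cases hyS : y ∈ S
      · exact Or.inl ⟨y, hyS, Or.inl rfl⟩
      · obtain ⟨p, hp, hyp⟩ := h.cover y hyW hyS
        by_cases hpf : ∃ s ∈ S, f s = p
        · obtain ⟨s, hs, rfl⟩ := hpf
          exact Or.inl ⟨s, hs, Or.inr hyp⟩
        · push Not at hpf
          exact Or.inr ⟨p, ⟨hp, hpf⟩, fun e => hy p ⟨hp, hpf⟩ e.symm, hyp⟩
    · rintro (⟨s, hs, rfl | hy⟩ | ⟨p, ⟨hp, hpf⟩, hyc, hyp⟩)
      · refine ⟨h.sep_subset hs, ?_⟩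
        rintro p ⟨hp, hpf⟩ rfl
        exact h.notMem_sep p hp _ (hc p hp (by simpa using hpf)) hs
      · refine ⟨h.part_subset _ (hfP s hs) hy, ?_⟩
        rintro p ⟨hp, hpf⟩ rfl
        exact hpf s hs (h.eq_of_mem _ (hfP s hs) _ hp _ hy (hc p hp (by simpa using hpf)))
      · refine ⟨h.part_subset p hp hyp, ?_⟩
        rintro q ⟨hq, hqf⟩ rfl
        have := h.eq_of_mem _ hp _ hq _ hyp (hc q hq (by simpa using hqf))
        exact hyc (by rw [this])
  rw [key]
  refine (PerfectlyMatched.biUnion _ _ ?_ ?_).union (PerfectlyMatched.biUnion _ _ ?_ ?_) ?_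
  · intro s hs
    have hsf : s ∉ f s := fun hs' => h.notMem_sep _ (hfP s hs) _ hs' hs
    -- `s` is paired with its neighbor `x s`; factor-criticality matches the rest of `f s`.
    rw [← insert_erase (hx s hs)]
    refine .insert_pair (h.factorCritical _ (hfP s hs) _ (hx s hs)) ?_ (by simp) ?_ (hsx s hs)
    · exact fun hs' => hsf (mem_of_mem_erase hs')
    · intro e
      have hxs := hx s hs
      rw [← e] at hxs
      exact hsf hxs
  · intro s hs t ht hst
    have hs' : s ∈ S := hs
    have ht' : t ∈ S := ht
    rw [Function.onFun, Finset.disjoint_left]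
    intro y hy hy'
    rw [mem_insert] at hy hy'
    rcases hy with rfl | hy <;> rcases hy' with rfl | hy'
    · exact hst rfl
    · exact h.notMem_sep _ (hfP _ ht') _ hy' hs'
    · exact h.notMem_sep _ (hfP _ hs') _ hy ht'
    · exact hst (hinj hs ht (h.eq_of_mem _ (hfP _ hs') _ (hfP _ ht') _ hy hy'))
  · intro p hp
    rw [mem_sdiff] at hp
    exact h.factorCritical _ hp.1 _ (hc p hp.1 hp.2)
  · intro p hp q hq hpq
    rw [mem_coe, mem_sdiff] at hp hq
    rw [Function.onFun, Finset.disjoint_left]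
    intro y hy hy'
    exact hpq (h.eq_of_mem _ hp.1 _ hq.1 _ (mem_of_mem_erase hy) (mem_of_mem_erase hy'))
  · rw [Finset.disjoint_left]
    intro y hy hy'
    simp only [mem_biUnion, mem_insert, mem_sdiff, mem_image, not_exists, not_and,
      mem_erase] at hy hy'
    obtain ⟨p, ⟨hp, hpf⟩, -, hyp⟩ := hy'
    obtain ⟨s, hs, rfl | hy⟩ := hy
    · exact h.notMem_sep _ hp _ hyp hs
    · exact hpf s hs (h.eq_of_mem _ (hfP _ hs) _ hp _ hy hyp)

open scoped Classical in
theorem IsGallaiPartition.exists_injOn (h : IsGallaiPartition r W S P) :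
    ∃ f : α → Finset α, Set.InjOn f S ∧ ∀ s ∈ S, f s ∈ P ∧ ∃ x ∈ f s, r s x := by
  obtain ⟨f, hf, hf'⟩ := Finset.exists_injOn_of_hall S
    (fun s => {p ∈ P | ∃ x ∈ p, r s x}) (fun T hT => by
      refine (h.hall T hT).trans (card_le_card ?_)
      intro p hp
      simp only [mem_filter, mem_biUnion] at hp ⊢
      obtain ⟨hp, s, hs, hx⟩ := hp
      exact ⟨s, hs, hp, hx⟩)
  exact ⟨f, hf, fun s hs => by simpa using hf' s hs⟩

theorem IsGallaiPartition.card_sep_le (h : IsGallaiPartition r W S P) : #S ≤ #P := by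
  classical
  exact (h.hall S subset_rfl).trans (card_le_card (filter_subset _ _))

theorem IsGallaiPartition.perfectlyMatched_of_card_eq (h : IsGallaiPartition r W S P)
    (hSP : #S = #P) : PerfectlyMatched r W := by
  classical
  obtain ⟨f, hinj, hf⟩ := h.exists_injOn
  have himg : S.image f = P := by
    apply eq_of_subset_of_card_le
    · exact image_subset_iff.2 fun s hs => (hf s hs).1
    · rw [card_image_of_injOn hinj, hSP]
  rcases isEmpty_or_nonempty α with hα | hα
  · rw [eq_empty_of_isEmpty W]
    exact .empty
  -- Every part is used by `f`, so the choice of omitted vertices is vacuous.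
  · simpa [himg] using h.perfectlyMatched f hinj hf (fun _ => Classical.arbitrary α)
      (fun p hp hpf => absurd hp (by rwa [himg] at hpf))

open scoped Classical in
theorem IsGallaiPartition.card_eq (h : IsGallaiPartition r W S P) :
    #W = #S + ∑ p ∈ P, #p := by
  have : W = S ∪ P.biUnion id := by
    ext y
    simp only [mem_union, mem_biUnion, id]
    constructor
    · intro hy
      by_cases hyS : y ∈ S
      · exact Or.inl hyS
      · exact Or.inr (h.cover y hy hyS)
    · rintro (hy | ⟨p, hp, hy⟩)
      · exact h.sep_subset hy
      · exact h.part_subset p hp hy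
  conv_lhs => rw [this]
  rw [card_union_of_disjoint, card_biUnion]
  · rfl
  · intro p hp q hq hpq
    exact Finset.disjoint_left.2 fun y hy hy' => hpq (h.eq_of_mem _ hp _ hq _ hy hy')
  · rw [Finset.disjoint_left]
    intro y hy hy'
    obtain ⟨p, hp, hyp⟩ := mem_biUnion.1 hy'
    exact h.notMem_sep p hp y hyp hy

theorem IsGallaiPartition.even_card_iff (h : IsGallaiPartition r W S P) :
    Even #W ↔ Even (#S + #P) := by
  classical
  have h1 := odd_sum_iff_odd_card_odd (s := P) (fun p => #p)
  rw [filter_true_of_mem h.odd_card] at h1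
  rw [h.card_eq, Nat.even_add, Nat.even_add, ← Nat.not_odd_iff_even (n := ∑ p ∈ P, #p), h1,
    Nat.not_odd_iff_even]

/-! ### Berge's bound -/

/-- The number of vertices covered by a matching is bounded by an odd separation. -/
theorem PerfectlyMatched.card_filter_odd_le {X : Finset α} (hX : PerfectlyMatched r X)
    (hr : ∀ x y, r x y → r y x) (h : IsOddSeparation r W S P) (hXW : X ⊆ W) [DecidableEq α] :
    #{p ∈ P | Odd #(p ∩ X)} ≤ #(X ∩ S) := by
  induction hX with
  | empty => simp
  | @insert_pair X a b hX ha hb hne hab ih =>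
    have hd : (fun a b => Classical.propDecidable (a = b)) = ‹DecidableEq α› :=
      Subsingleton.elim _ _
    rw [hd] at hXW ⊢
    have haW : a ∈ W := hXW (by simp)
    have hbW : b ∈ W := hXW (by simp)
    have ih := ih ((subset_insert _ _).trans ((subset_insert _ _).trans hXW))
    -- If one end of the new pair lies in `S`, the other lies in at most one part. So at most one
    -- parity changes, while `X ∩ S` gains an element.
    have aux : ∀ a b, a ∈ S → a ∉ X → b ∉ X → a ≠ b →
        #{p ∈ P | Odd #(p ∩ insert a (insert b X))} ≤ #(insert a (insert b X) ∩ S) := by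
      intro a b haS ha hb hne
      have h1 : {p ∈ P | Odd #(p ∩ insert a (insert b X))} ⊆
          {p ∈ P | Odd #(p ∩ X)} ∪ {p ∈ P | b ∈ p} := by
        intro p hp
        simp only [mem_filter, mem_union] at hp ⊢
        by_cases hbp : b ∈ p
        · exact Or.inr ⟨hp.1, hbp⟩
        · rw [inter_insert_of_notMem (fun hap => h.notMem_sep p hp.1 a hap haS),
            inter_insert_of_notMem hbp] at hp
          exact Or.inl hp
      have h2 : #{p ∈ P | b ∈ p} ≤ 1 := by
        rw [card_le_one]
        intro p hp q hq
        simp only [mem_filter] at hp hq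
        exact h.eq_of_mem _ hp.1 _ hq.1 b hp.2 hq.2
      have h3 : #(X ∩ S) + 1 ≤ #(insert a (insert b X) ∩ S) := by
        rw [insert_inter_of_mem haS, card_insert_of_notMem (by simp [ha, hne])]
        gcongr
        exact subset_insert _ _
      have := (card_le_card h1).trans (card_union_le _ _)
      omega
    by_cases haS : a ∈ S
    · exact aux a b haS ha hb hne
    by_cases hbS : b ∈ S
    · rw [insert_comm]
      exact aux b a hbS hb ha hne.symm
    rw [insert_inter_of_notMem haS, insert_inter_of_notMem hbS]
    refine (card_le_card ?_).trans ih
    intro p hp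
    simp only [mem_filter] at hp ⊢
    refine ⟨hp.1, ?_⟩
    -- With both ends outside `S`, closedness puts both or neither in `p`, so the parity is
    -- unchanged.
    by_cases hap : a ∈ p
    · have hbp := h.closed p hp.1 a hap b hbW hbS hab
      have := hp.2
      rw [inter_insert_of_mem hap, inter_insert_of_mem hbp,
        card_insert_of_notMem (by simp [ha, hne]), card_insert_of_notMem (by simp [hb])] at this
      simpa [Nat.odd_add_one] using this
    · have hbp : b ∉ p := fun hbp => hap (h.closed p hp.1 b hbp a haW haS (hr _ _ hab))
      simpa only [inter_insert_of_notMem hap, inter_insert_of_notMem hbp] using hp.2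

/-- The easy half of Berge's formula, which certifies maximality. A part meeting `X` in an even
number of vertices is odd, hence misses a vertex; the remaining parts number at most `#(X ∩ S)` by
`card_filter_odd_le`. -/
theorem PerfectlyMatched.card_add_card_le {X : Finset α} (hX : PerfectlyMatched r X)
    (hr : ∀ x y, r x y → r y x) (h : IsOddSeparation r W S P) (hXW : X ⊆ W) :
    #X + #P ≤ #W + #S := by
  classical
  have h1 := hX.card_filter_odd_le hr h hXW
  have h2 : #{p ∈ P | ¬ Odd #(p ∩ X)} ≤ #((W \ S) \ X) := by
    have hne : ∀ p ∈ P, ¬ Odd #(p ∩ X) → ∃ x ∈ p, x ∉ X := by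
      intro p hp hodd
      by_contra! hcon
      rw [inter_eq_left.2 hcon] at hodd
      exact hodd (h.odd_card p hp)
    rcases isEmpty_or_nonempty α with hα | hα
    · refine (card_eq_zero.2 (filter_eq_empty_iff.2 fun p hp hodd => ?_)).trans_le (Nat.zero_le _)
      obtain ⟨x, -⟩ := hne p hp hodd
      exact isEmptyElim x
    choose! g hg hgX using hne
    refine card_le_card_of_injOn g ?_ ?_
    · intro p hp
      simp only [mem_coe, mem_filter] at hp
      simp only [mem_coe, mem_sdiff]
      exact ⟨⟨h.part_subset p hp.1 (hg p hp.1 hp.2), h.notMem_sep p hp.1 _ (hg p hp.1 hp.2)⟩,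
        hgX p hp.1 hp.2⟩
    · intro p hp q hq hpq
      simp only [mem_coe, mem_filter] at hp hq
      refine h.eq_of_mem _ hp.1 _ hq.1 _ (hg p hp.1 hp.2) ?_
      rw [hpq]
      exact hg q hq.1 hq.2
  have h3 := card_filter_add_card_filter_not (s := P) (fun p => Odd #(p ∩ X))
  have h4 : #((W \ S) \ X) + #(X \ S) ≤ #(W \ S) := by
    rw [← card_union_of_disjoint]
    · apply card_le_card
      intro y hy
      simp only [mem_union, mem_sdiff] at hy ⊢
      rcases hy with hy | hy
      · exact hy.1
      · exact ⟨hXW hy.1, hy.2⟩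
    · rw [Finset.disjoint_left]
      intro y hy hy'
      simp only [mem_sdiff] at hy hy'
      exact hy.2 hy'.1
  have h5 := card_sdiff_add_card_eq_card h.sep_subset
  have h6 := card_sdiff_add_card_inter X S
  have h7 : #(X ∩ S) ≤ #S := card_le_card inter_subset_right
  omega

theorem IsOddSeparation.empty : IsOddSeparation r W ∅ ∅ := by
  constructor <;> simp

/-! ### Existence of Gallai partitions -/

/-- Every set has an odd separation `(S, P)` maximizing `#P - #S` and, subject to this, `#S`. -/
theorem exists_maximal_oddSeparation (r : α → α → Prop) (W : Finset α) :
    ∃ S P, IsOddSeparation r W S P ∧ ∀ S' P', IsOddSeparation r W S' P' →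
      #P' + #S < #P + #S' ∨ (#P' + #S = #P + #S' ∧ #S' ≤ #S) := by
  classical
  obtain ⟨⟨S, P⟩, hm, hmax⟩ := Finset.exists_max_image
    ({x ∈ W.powerset ×ˢ W.powerset.powerset | IsOddSeparation r W x.1 x.2})
    -- The difference is taken in `ℤ`, since it may be negative.
    (fun x => toLex (((#x.2 : ℤ) - #x.1), #x.1)) ⟨(∅, ∅), by simp [IsOddSeparation.empty]⟩
  simp only [mem_filter] at hm
  refine ⟨S, P, hm.2, fun S' P' h' => ?_⟩
  have := hmax (S', P') (by
    simp only [mem_filter, mem_product, mem_powerset]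
    exact ⟨⟨h'.sep_subset, fun p hp => mem_powerset.2 (h'.part_subset p hp)⟩, h'⟩)
  rw [Prod.Lex.toLex_le_toLex] at this
  simp only at this
  omega

/-- Used with `D` empty or a singleton to show that an extremal separation leaves no uncovered set
`U`. -/
theorem IsOddSeparation.insert_part [DecidableEq α] (hr : ∀ x y, r x y → r y x)
    (h : IsOddSeparation r W S P)
    {U D : Finset α} (hU : ∀ x, x ∈ U ↔ x ∈ W ∧ x ∉ S ∧ ∀ p ∈ P, x ∉ p) (hD : D ⊆ U)
    (hodd : Odd #(U \ D)) :
    IsOddSeparation r W (S ∪ D) (insert (U \ D) P) := by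
  refine ⟨?_, ?_, ?_, ?_, ?_, ?_⟩
  · exact union_subset h.sep_subset fun x hx => ((hU x).1 (hD hx)).1
  · rw [forall_mem_insert]
    exact ⟨fun x hx => ((hU x).1 (mem_sdiff.1 hx).1).1, h.part_subset⟩
  · rw [forall_mem_insert]
    refine ⟨fun x hx => ?_, fun p hp x hx => ?_⟩
    · rw [mem_sdiff, hU] at hx
      simp [hx.1.2.1, hx.2]
    · rw [mem_union, not_or]
      exact ⟨h.notMem_sep p hp x hx, fun hxD => ((hU x).1 (hD hxD)).2.2 p hp hx⟩
  · rw [forall_mem_insert]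
    exact ⟨hodd, h.odd_card⟩
  · rw [forall_mem_insert]
    refine ⟨fun x hx y hyW hyS hxy => ?_, fun p hp x hx y hyW hyS hxy => ?_⟩
    · rw [mem_union, not_or] at hyS
      rw [mem_sdiff] at hx ⊢
      have hx' := (hU x).1 hx.1
      refine ⟨(hU y).2 ⟨hyW, hyS.1, fun p hp hyp => ?_⟩, hyS.2⟩
      exact hx'.2.2 p hp (h.closed p hp y hyp x hx'.1 hx'.2.1 (hr _ _ hxy))
    · rw [mem_union, not_or] at hyS
      exact h.closed p hp x hx y hyW hyS.1 hxy
  · have aux : ∀ p ∈ P, ∀ x ∈ p, x ∉ U \ D := fun p hp x hx hxU =>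
      ((hU x).1 (mem_sdiff.1 hxU).1).2.2 p hp hx
    rw [forall_mem_insert]
    refine ⟨?_, fun p hp => ?_⟩
    · rw [forall_mem_insert]
      exact ⟨fun _ _ _ => rfl, fun q hq x hx hxq => absurd hx (aux q hq x hxq)⟩
    · rw [forall_mem_insert]
      exact ⟨fun x hx hxU => absurd hxU (aux p hp x hx), h.eq_of_mem p hp⟩

/-- Used for factor-criticality: if `p.erase c` has at least two more parts than separating
vertices, the surplus pays for the lost part `p` and the new separating vertex `c`. -/
theorem IsOddSeparation.refine_part [DecidableEq α] (h : IsOddSeparation r W S P)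
    {p : Finset α} (hp : p ∈ P) {c : α} (hc : c ∈ p) {S' : Finset α} {P' : Finset (Finset α)}
    (h' : IsOddSeparation r (p.erase c) S' P') :
    IsOddSeparation r W (S ∪ insert c S') (P.erase p ∪ P') := by
  have hS' : insert c S' ⊆ p :=
    insert_subset hc (h'.sep_subset.trans (erase_subset _ _))
  have hP' : ∀ q ∈ P', q ⊆ p := fun q hq => (h'.part_subset q hq).trans (erase_subset _ _)
  have hcross : ∀ q ∈ P.erase p, ∀ x ∈ q, x ∉ p := fun q hq x hx hxp =>
    (mem_erase.1 hq).1 (h.eq_of_mem q (mem_erase.1 hq).2 p hp x hx hxp)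
  refine ⟨union_subset h.sep_subset (hS'.trans (h.part_subset p hp)), ?_, ?_, ?_, ?_, ?_⟩
  · rw [forall_mem_union]
    exact ⟨fun q hq => h.part_subset q (mem_erase.1 hq).2,
      fun q hq => (hP' q hq).trans (h.part_subset p hp)⟩
  · rw [forall_mem_union]
    refine ⟨fun q hq x hx => ?_, fun q hq x hx => ?_⟩ <;> rw [mem_union, not_or]
    · exact ⟨h.notMem_sep q (mem_erase.1 hq).2 x hx, fun hxS => hcross q hq x hx (hS' hxS)⟩
    · refine ⟨h.notMem_sep p hp x (hP' q hq hx), fun hxS => ?_⟩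
      rcases mem_insert.1 hxS with rfl | hxS
      · exact notMem_erase _ _ (h'.part_subset q hq hx)
      · exact h'.notMem_sep q hq x hx hxS
  · rw [forall_mem_union]
    exact ⟨fun q hq => h.odd_card q (mem_erase.1 hq).2, h'.odd_card⟩
  · rw [forall_mem_union]
    refine ⟨fun q hq x hx y hyW hyS hxy => ?_, fun q hq x hx y hyW hyS hxy => ?_⟩ <;>
      rw [mem_union, mem_insert, not_or, not_or] at hyS
    · exact h.closed q (mem_erase.1 hq).2 x hx y hyW hyS.1 hxy
    · exact h'.closed q hq x hx y
        (mem_erase.2 ⟨hyS.2.1, h.closed p hp x (hP' q hq hx) y hyW hyS.1 hxy⟩) hyS.2.2 hxy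
  · rw [forall_mem_union]
    refine ⟨fun q hq => ?_, fun q hq => ?_⟩ <;> rw [forall_mem_union]
    · exact ⟨fun q' hq' => h.eq_of_mem q (mem_erase.1 hq).2 q' (mem_erase.1 hq').2,
        fun q' hq' x hx hx' => absurd (hP' q' hq' hx') (hcross q hq x hx)⟩
    · exact ⟨fun q' hq' x hx hx' => absurd (hP' q hq hx) (hcross q' hq' x hx'),
        h'.eq_of_mem q hq⟩

-- Used for Hall's condition: a set `T` violating it could be dropped from `S`, together with the
-- parts it meets by an edge, to increase `#P - #S`.
open scoped Classical in
theorem IsOddSeparation.remove (hr : ∀ x y, r x y → r y x) (h : IsOddSeparation r W S P)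
    (T : Finset α) :
    IsOddSeparation r W (S \ T) {p ∈ P | ¬ ∃ s ∈ T, ∃ x ∈ p, r s x} := by
  have hP : ∀ p ∈ ({p ∈ P | ¬ ∃ s ∈ T, ∃ x ∈ p, r s x} : Finset _), p ∈ P := fun p hp =>
    (mem_filter.1 hp).1
  refine ⟨sdiff_subset.trans h.sep_subset, fun p hp => h.part_subset p (hP p hp),
    fun p hp x hx hxS => h.notMem_sep p (hP p hp) x hx (mem_sdiff.1 hxS).1,
    fun p hp => h.odd_card p (hP p hp), fun p hp x hx y hyW hyS hxy => ?_,
    fun p hp q hq => h.eq_of_mem p (hP p hp) q (hP q hq)⟩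
  refine h.closed p (hP p hp) x hx y hyW (fun hyS' => ?_) hxy
  have hyT : y ∈ T := by
    by_contra hyT
    exact hyS (mem_sdiff.2 ⟨hyS', hyT⟩)
  exact (mem_filter.1 hp).2 ⟨y, hyT, x, hx, hr _ _ hxy⟩

/-- Every finite set of vertices has a Gallai partition. -/
theorem exists_isGallaiPartition (hr : ∀ x y, r x y → r y x) (W : Finset α) :
    ∃ S P, IsGallaiPartition r W S P := by
  classical
  induction W using Finset.strongInduction with
  | H W ih =>
  obtain ⟨S, P, h, hmax⟩ := exists_maximal_oddSeparation r W
  refine ⟨S, P, { h with cover := ?_, factorCritical := ?_, hall := ?_ }⟩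
  · intro x hxW hxS
    by_contra! hx
    set U : Finset α := {x ∈ W | x ∉ S ∧ ∀ p ∈ P, x ∉ p} with hUdef
    have hU : ∀ x, x ∈ U ↔ x ∈ W ∧ x ∉ S ∧ ∀ p ∈ P, x ∉ p := by simp [hUdef]
    have hxU : x ∈ U := (hU x).2 ⟨hxW, hxS, hx⟩
    have hnot : ∀ D, Odd #(U \ D) → U \ D ∉ P := by
      intro D hodd hmem
      obtain ⟨y, hy⟩ := card_pos.1 hodd.pos
      exact ((hU y).1 (mem_sdiff.1 hy).1).2.2 _ hmem hy
    -- An odd `U` would be a further part, raising `#P - #S`. From a nonempty even `U`, moving one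
    -- vertex to `S` keeps the difference and enlarges `S`.
    by_cases hodd : Odd #U
    · rw [← sdiff_empty (s := U)] at hodd
      have := hmax _ _ (h.insert_part hr hU (empty_subset _) hodd)
      rw [card_insert_of_notMem (hnot _ hodd), union_empty] at this
      omega
    · have hodd' : Odd #(U \ {x}) := by
        rw [sdiff_singleton_eq_erase, card_erase_of_mem hxU]
        exact Nat.Even.sub_odd (card_pos.2 ⟨x, hxU⟩) (Nat.not_odd_iff_even.1 hodd) odd_one
      have := hmax _ _ (h.insert_part hr hU (singleton_subset_iff.2 hxU) hodd')
      rw [card_insert_of_notMem (hnot _ hodd'),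
        card_union_of_disjoint (disjoint_singleton_right.2 hxS), card_singleton] at this
      omega
  · intro p hp c hc
    obtain ⟨S', P', h'⟩ := ih (p.erase c)
      ((erase_ssubset hc).trans_subset (h.part_subset p hp))
    rcases h'.card_sep_le.eq_or_lt with heq | hlt
    · exact h'.perfectlyMatched_of_card_eq heq
    exfalso
    have heven : Even #(p.erase c) := by
      rw [card_erase_of_mem hc]
      exact Nat.Odd.sub_odd (h.odd_card p hp) odd_one
    rw [h'.even_card_iff] at heven
    -- The two cardinalities have the same parity, so a strict inequality has a gap of at least two.
    have hlt' : #S' + 2 ≤ #P' := by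
      obtain ⟨m, hm⟩ := heven
      omega
    have := hmax _ _ (h.refine_part hp hc h'.toIsOddSeparation)
    have hcS' : c ∉ S' := fun hcS' => notMem_erase _ _ (h'.sep_subset hcS')
    rw [card_union_of_disjoint, card_union_of_disjoint, card_insert_of_notMem hcS',
      card_erase_of_mem hp] at this
    · have := card_pos.2 ⟨p, hp⟩
      omega
    · rw [Finset.disjoint_left]
      intro x hxS hx
      have : insert c S' ⊆ p := insert_subset hc (h'.sep_subset.trans (erase_subset _ _))
      exact h.notMem_sep p hp x (this hx) hxS
    · rw [Finset.disjoint_left]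
      intro q hq hq'
      obtain ⟨x, hx⟩ := card_pos.1 (h'.odd_card q hq').pos
      exact (mem_erase.1 hq).1 (h.eq_of_mem q (mem_erase.1 hq).2 p hp x hx
        (mem_of_mem_erase (h'.part_subset q hq' hx)))
  · intro T hT
    have := hmax _ _ (h.remove hr T)
    have h1 := card_filter_add_card_filter_not (s := P) (fun p => ∃ s ∈ T, ∃ x ∈ p, r s x)
    have h2 := card_sdiff_add_card_eq_card hT
    omega

end

/-! ### Choosing the missed parts and vertices -/

section

variable {α : Type*} {r : α → α → Prop} {W S : Finset α} {P : Finset (Finset α)}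

open scoped Classical in
/-- A family of parts that can be matched into `S` is covered by some matching of all of `S` into
the parts. -/
theorem IsGallaiPartition.exists_injOn_covering (h : IsGallaiPartition r W S P)
    {B : Finset (Finset α)} (hB : B ⊆ P) (g : Finset α → α) (hg : Set.InjOn g B)
    (hgS : ∀ p ∈ B, g p ∈ S ∧ ∃ x ∈ p, r (g p) x) :
    ∃ f : α → Finset α, Set.InjOn f S ∧ (∀ s ∈ S, f s ∈ P ∧ ∃ x ∈ f s, r s x) ∧
      B ⊆ S.image f := by
  obtain ⟨f₀, hf₀, hf₀P⟩ := h.exists_injOn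
  -- With `d` dummy elements added to `S`, a matching of all parts becomes a bijection. Parts in `B`
  -- are denied the dummies, so they must be matched into `S`.
  set d := #P - #S with hd
  have hdS : #S + d = #P := Nat.add_sub_of_le h.card_sep_le
  obtain ⟨φ, hφ, hφt⟩ := Finset.exists_injOn_of_hall (κ := α ⊕ ℕ) P
    (fun p => ({a ∈ S | ∃ x ∈ p, r a x}).disjSum (if p ∈ B then ∅ else range d)) (by
      intro u hu
      by_cases huB : u ⊆ B
      · rw [← card_image_of_injOn (s := u) (f := fun p => (Sum.inl (g p) : α ⊕ ℕ))
          (fun p hp q hq hpq => hg (huB hp) (huB hq) (Sum.inl_injective hpq))]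
        refine card_le_card (image_subset_iff.2 fun p hp => mem_biUnion.2 ⟨p, hp, ?_⟩)
        rw [inl_mem_disjSum, mem_filter]
        exact hgS p (huB hp)
      · obtain ⟨p₀, hp₀, hp₀B⟩ := not_subset.1 huB
        set N : Finset α := {a ∈ S | ∃ p ∈ u, ∃ x ∈ p, r a x} with hN
        have h1 : N.disjSum (range d) ⊆ u.biUnion (fun p =>
            ({a ∈ S | ∃ x ∈ p, r a x}).disjSum (if p ∈ B then ∅ else range d)) := by
          rintro (a | i) hi
          · rw [inl_mem_disjSum, hN, mem_filter] at hi
            obtain ⟨haS, p, hp, hx⟩ := hi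
            exact mem_biUnion.2 ⟨p, hp, by simpa using ⟨haS, hx⟩⟩
          · refine mem_biUnion.2 ⟨p₀, hp₀, ?_⟩
            simpa [hp₀B] using hi
        -- No vertex of `S \ N` is joined to a part in `u`, so `f₀` sends it outside `u`. This gives
        -- `#u ≤ #N + d`.
        have h2 : #(S \ N) ≤ #(P \ u) := by
          refine card_le_card_of_injOn f₀ ?_ (hf₀.mono (by simp))
          intro s hs
          rw [mem_coe, mem_sdiff] at hs
          rw [mem_coe, mem_sdiff]
          refine ⟨(hf₀P s hs.1).1, fun hsu => hs.2 ?_⟩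
          rw [hN, mem_filter]
          exact ⟨hs.1, f₀ s, hsu, (hf₀P s hs.1).2⟩
        have h3 := card_le_card h1
        rw [card_disjSum, card_range] at h3
        have h4 := card_sdiff_add_card_eq_card hu
        have hNS : N ⊆ S := filter_subset _ _
        have h5 := card_sdiff_add_card_eq_card hNS
        omega)
  have himg : P.image φ = S.disjSum (range d) := by
    apply eq_of_subset_of_card_le
    · refine image_subset_iff.2 fun p hp => ?_
      refine disjSum_mono (filter_subset _ _) ?_ (hφt p hp)
      split_ifs <;> simp
    · rw [card_image_of_injOn hφ, card_disjSum, card_range, hdS]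
  have hex : ∀ s ∈ S, ∃ p ∈ P, φ p = Sum.inl s := by
    intro s hs
    have : (Sum.inl s : α ⊕ ℕ) ∈ P.image φ := by
      rw [himg]
      simpa using hs
    simpa using this
  choose! f hfP hφf using hex
  refine ⟨f, ?_, ?_, ?_⟩
  · intro s hs t ht hst
    have := hφf s hs
    rw [hst, hφf t ht] at this
    exact (Sum.inl_injective this).symm
  · intro s hs
    have := hφt _ (hfP s hs)
    rw [hφf s hs, inl_mem_disjSum, mem_filter] at this
    exact ⟨hfP s hs, this.2⟩
  · intro p hp
    have := hφt p (hB hp)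
    rw [if_pos hp, mem_disjSum] at this
    obtain ⟨a, ha, hap⟩ | ⟨_, hb, -⟩ := this
    · have haS := (mem_filter.1 ha).1
      refine mem_image.2 ⟨a, haS, hφ (hfP a haS) (hB hp) ?_⟩
      rw [hφf a haS, hap]
    · simp at hb

open scoped Classical in
/-- If every subfamily of `B` is joined by many edges to `S`, where `d p` counts the edges from
`p` to `S` and each vertex of `S` has degree at most `k`, then the parts of `B` can be assigned to
neighbors in `S` such that each vertex of `S` is used at most once with each label, and only
parts with `d p < k` have label `false`. -/
theorem exists_injOn_two_copies {B : Finset (Finset α)} {k : ℕ} (hk : 0 < k) (d : Finset α → ℕ)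
    (hα : Nonempty α)
    (hcount : ∀ u ⊆ B, ∑ p ∈ u, d p ≤ k * #{a ∈ S | ∃ p ∈ u, ∃ x ∈ p, r a x})
    (hd : ∀ p ∈ B, k ≤ 2 * d p) :
    ∃ g : Finset α → α × Bool, Set.InjOn g B ∧
      ∀ p ∈ B, (g p).1 ∈ S ∧ (∃ x ∈ p, r (g p).1 x) ∧ ((g p).2 = false → d p < k) := by
  obtain ⟨g, hg, hgt⟩ := Finset.exists_injOn_of_hall (κ := α × Bool) B
    (fun p => ({a ∈ S | ∃ x ∈ p, r a x}) ×ˢ (if k ≤ d p then {true} else {true, false})) (by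
      intro u hu
      -- Only the parts in `v` may use the second copy of `S`, so the available labels include `N u`
      -- in the first copy and `N v` in the second.
      set v : Finset (Finset α) := {p ∈ u | ¬ k ≤ d p} with hv
      set N : Finset (Finset α) → Finset α := fun u => {a ∈ S | ∃ p ∈ u, ∃ x ∈ p, r a x} with hN
      have h1 : N u ×ˢ {true} ∪ N v ×ˢ {false} ⊆ u.biUnion (fun p =>
          ({a ∈ S | ∃ x ∈ p, r a x}) ×ˢ (if k ≤ d p then {true} else {true, false})) := by
        rintro ⟨a, b⟩ hab
        simp only [hN, hv, mem_union, mem_product, mem_filter, mem_singleton] at hab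
        rw [mem_biUnion]
        rcases hab with ⟨⟨haS, p, hp, hx⟩, rfl⟩ | ⟨⟨haS, p, ⟨hp, hpk⟩, hx⟩, rfl⟩
        · refine ⟨p, hp, mem_product.2 ⟨mem_filter.2 ⟨haS, hx⟩, ?_⟩⟩
          split_ifs <;> simp
        · refine ⟨p, hp, mem_product.2 ⟨mem_filter.2 ⟨haS, hx⟩, ?_⟩⟩
          simp [hpk]
      have h2 := card_le_card h1
      rw [card_union_of_disjoint (by
        rw [Finset.disjoint_left]
        rintro ⟨a, b⟩ hab hab'
        simp only [mem_product, mem_singleton] at hab hab'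
        simp [hab.2] at hab'), card_product, card_product, card_singleton, card_singleton,
        mul_one, mul_one] at h2
      refine le_trans (Nat.le_of_mul_le_mul_left ?_ hk) h2
      have h3 := hcount u hu
      have h4 := hcount v ((filter_subset _ _).trans hu)
      have h5 := sum_filter_add_sum_filter_not u (fun p => k ≤ d p) d
      have h6 : ∑ p ∈ u with k ≤ d p, k ≤ ∑ p ∈ u with k ≤ d p, d p :=
        sum_le_sum fun p hp => (mem_filter.1 hp).2
      have h7 : ∑ p ∈ v, k ≤ ∑ p ∈ v, 2 * d p :=
        sum_le_sum fun p hp => hd p (hu (mem_filter.1 hp).1)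
      have h8 := card_filter_add_card_filter_not (s := u) (fun p => k ≤ d p)
      rw [← mul_sum] at h7
      rw [sum_const, smul_eq_mul] at h6 h7
      -- A part outside `v` pays `k` with its edges counted once; a part in `v` pays `k` with its
      -- edges counted twice, once in each copy.
      calc k * #u = #{p ∈ u | k ≤ d p} * k + #v * k := by rw [← h8]; ring
        _ ≤ ∑ p ∈ u with k ≤ d p, d p + 2 * ∑ p ∈ v, d p := by omega
        _ = ∑ p ∈ u, d p + ∑ p ∈ v, d p := by rw [← h5]; ring
        _ ≤ k * #(N u) + k * #(N v) := by gcongr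
        _ = k * (#(N u) + #(N v)) := by ring)
  refine ⟨g, hg, fun p hp => ?_⟩
  have := mem_product.1 (hgt p hp)
  rw [mem_filter] at this
  refine ⟨this.1.1, this.1.2, fun hf => ?_⟩
  by_contra hcon
  rw [if_pos (not_lt.1 hcon), hf] at this
  simp at this

open scoped Classical in
/-- In a Gallai partition in which each part has a vertex without neighbors in `S`, or is joined to
`S` by at least `k` edges, or is joined to `S` by at least `k / 2` edges and each of its vertices
has only one neighbor in `S`, there is a maximum perfectly matched set such that no two vertices
outside it have a common neighbor. -/
theorem IsGallaiPartition.exists_perfectlyMatched (hr : ∀ x y, r x y → r y x)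
    (h : IsGallaiPartition r W S P) (hW : ∀ x y, r x y → x ∈ W) {k : ℕ} (hk : 0 < k)
    (d : Finset α → ℕ)
    (hcount : ∀ u ⊆ P, ∑ p ∈ u, d p ≤ k * #{a ∈ S | ∃ p ∈ u, ∃ x ∈ p, r a x})
    (hpart : ∀ p ∈ P, (∃ x ∈ p, ∀ a ∈ S, ¬ r a x) ∨ k ≤ d p ∨
      (k ≤ 2 * d p ∧ ∀ x ∈ p, ∀ a ∈ S, ∀ b ∈ S, r a x → r b x → a = b)) :
    ∃ X ⊆ W, PerfectlyMatched r X ∧ (∀ Y ⊆ W, PerfectlyMatched r Y → #Y ≤ #X) ∧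
      ∀ x ∈ W, x ∉ X → ∀ y ∈ W, y ∉ X → x ≠ y → ∀ z, r x z → ¬ r y z := by
  rcases isEmpty_or_nonempty α with hα | hα
  · exact ⟨∅, empty_subset _, .empty, fun Y _ _ => by simp [eq_empty_of_isEmpty Y],
      fun x => isEmptyElim x⟩
  set B : Finset (Finset α) := {p ∈ P | ¬ ∃ x ∈ p, ∀ a ∈ S, ¬ r a x} with hB
  have hBP : B ⊆ P := filter_subset _ _
  obtain ⟨g, hg, hgB⟩ := exists_injOn_two_copies (r := r) (S := S) (B := B) hk d hα
    (fun u hu => hcount u (hu.trans hBP)) (fun p hp => by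
      rw [hB, mem_filter] at hp
      rcases hpart p hp.1 with h1 | h1 | h1
      · exact absurd h1 hp.2
      · omega
      · exact h1.1)
  obtain ⟨f, hf, hfP, hfB⟩ := h.exists_injOn_covering (B := {p ∈ B | (g p).2 = true})
    ((filter_subset _ _).trans hBP) (fun p => (g p).1)
    (fun p hp q hq hpq => by
      simp only [mem_coe, mem_filter] at hp hq
      exact hg hp.1 hq.1 (Prod.ext hpq (hp.2.trans hq.2.symm)))
    (fun p hp => by
      rw [mem_filter] at hp
      exact ⟨(hgB p hp.1).1, (hgB p hp.1).2.1⟩)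
  -- The missed vertex has no neighbor in `S`, or only the one reserved for its part by the `false`
  -- label.
  have hrep : ∀ p ∈ P, p ∉ S.image f → ∃ x ∈ p,
      (∀ a ∈ S, r a x → p ∈ B ∧ (g p).2 = false ∧ (g p).1 = a) := by
    intro p hp hpf
    by_cases hpB : p ∈ B
    · have hlabel : (g p).2 = false := by
        by_contra hcon
        exact hpf (hfB (mem_filter.2 ⟨hpB, by simpa using hcon⟩))
      obtain ⟨hgS, ⟨x, hx, hgx⟩, hlt⟩ := hgB p hpB
      refine ⟨x, hx, fun a ha hax => ⟨hpB, hlabel, ?_⟩⟩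
      rcases hpart p hp with h1 | h1 | h1
      · exact absurd h1 (mem_filter.1 hpB).2
      · exact absurd h1 (not_le.2 (hlt hlabel))
      · exact h1.2 x hx _ hgS _ ha hgx hax
    · have : ∃ x ∈ p, ∀ a ∈ S, ¬ r a x := by
        by_contra hcon
        exact hpB (mem_filter.2 ⟨hp, hcon⟩)
      obtain ⟨x, hx, hxS⟩ := this
      exact ⟨x, hx, fun a ha hax => absurd hax (hxS a ha)⟩
  choose! c hcp hc using hrep
  have hX := h.perfectlyMatched f hf hfP c hcp
  refine ⟨_, sdiff_subset, hX, fun Y hY hYm => ?_, ?_⟩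
  -- At most `#P - #S` vertices are omitted, which meets Berge's bound.
  · have h1 := hYm.card_add_card_le hr h.toIsOddSeparation hY
    have h2 : #((P \ S.image f).image c) ≤ #P - #S := by
      refine card_image_le.trans ?_
      rw [card_sdiff_of_subset (image_subset_iff.2 fun s hs => (hfP s hs).1),
        card_image_of_injOn hf]
    have h3 := le_card_sdiff ((P \ S.image f).image c) W
    have h4 := h.card_sep_le
    omega
  · intro x hxW hx y hyW hy hxy z hxz hyz
    simp only [mem_sdiff, hxW, hyW, true_and, not_not, mem_image (f := c)] at hx hy
    obtain ⟨p, ⟨hp, hpf⟩, rfl⟩ := hx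
    obtain ⟨q, ⟨hq, hqf⟩, rfl⟩ := hy
    -- A common neighbor in `S` would be reserved for both parts, contradicting injectivity of `g`;
    -- one outside `S` would lie in both parts.
    by_cases hzS : z ∈ S
    · obtain ⟨hpB, hpl, hpz⟩ := hc p hp hpf z hzS (hr _ _ hxz)
      obtain ⟨hqB, hql, hqz⟩ := hc q hq hqf z hzS (hr _ _ hyz)
      exact hxy (congrArg c (hg hpB hqB (Prod.ext (hpz.trans hqz.symm) (hpl.trans hql.symm))))
    · have hzW := hW _ _ (hr _ _ hxz)
      have := h.eq_of_mem p hp q hq z (h.closed p hp _ (hcp p hp hpf) z hzW hzS hxz)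
        (h.closed q hq _ (hcp q hq hqf) z hzW hzS hyz)
      exact hxy (congrArg c this)

end

/-! ### Matchings of multigraphs as perfectly matched sets -/

namespace Graph

variable {α β : Type*} {G : Graph α β}

theorem IsRegular.incidenceSet_encard [hl : G.Loopless] {k : ℕ} (h : G.IsRegular k) {x : α}
    (hx : x ∈ G.vertexSet) : (G.incidenceSet x).encard = k := by
  have h1 : G.loopSet x = ∅ := by
    ext e
    simp
  have := h x hx
  rwa [degree, h1, Set.encard_empty, add_zero] at this

theorem IsRegular.finite_edgeSet [G.Loopless] {k : ℕ} (h : G.IsRegular k)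
    (hV : G.vertexSet.Finite) : G.edgeSet.Finite := by
  refine (hV.biUnion (t := fun x => G.incidenceSet x) fun x hx =>
    Set.finite_of_encard_eq_coe (h.incidenceSet_encard hx)).subset fun e he => ?_
  obtain ⟨x, y, hxy⟩ := exists_isLink_of_mem_edgeSet he
  exact Set.mem_biUnion hxy.left_mem hxy.inc_left

/-- The vertices of a perfectly matched set are exactly those covered by some matching. -/
theorem exists_isMatching_of_perfectlyMatched {X : Finset α} (hX : PerfectlyMatched G.Adj X) :
    ∃ M : Set β, M.Finite ∧ G.IsMatching M ∧ (∀ x, x ∈ X ↔ ∃ e ∈ M, G.Inc e x) ∧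
      2 * M.ncard = #X := by
  classical
  induction hX with
  | empty => exact ⟨∅, Set.finite_empty, ⟨Set.empty_subset _, by simp⟩, by simp, by simp⟩
  | @insert_pair X a b hX ha hb hne hab ih =>
    obtain ⟨M, hfin, hM, hcov, hcard⟩ := ih
    obtain ⟨e, he⟩ := hab
    have heM : e ∉ M := fun heM => ha ((hcov a).2 ⟨e, heM, he.inc_left⟩)
    have hdisj : ∀ f ∈ M, ∀ x, G.Inc e x → ¬ G.Inc f x := by
      intro f hf x hex hfx
      have hx := (hcov x).2 ⟨f, hf, hfx⟩
      rcases hex.eq_or_eq_of_isLink he with rfl | rfl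
      · exact ha hx
      · exact hb hx
    refine ⟨insert e M, hfin.insert e, ⟨Set.insert_subset he.edge_mem hM.1, ?_⟩, ?_, ?_⟩
    · rintro f (rfl | hf) f' (rfl | hf') hff' x ⟨h1, h2⟩
      · exact hff' rfl
      · exact hdisj f' hf' x h1 h2
      · exact hdisj f hf x h2 h1
      · exact hM.2 f hf f' hf' hff' x ⟨h1, h2⟩
    · intro x
      have hd : ∀ x, G.Inc e x ↔ x = a ∨ x = b := fun x =>
        ⟨fun hx => hx.eq_or_eq_of_isLink he, by
          rintro (rfl | rfl)
          exacts [he.inc_left, he.inc_right]⟩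
      simp [hd, hcov, or_assoc]
    · rw [Set.ncard_insert_of_notMem heM hfin, mul_add, hcard,
        card_insert_of_notMem (by simp [ha, hne]), card_insert_of_notMem hb]

theorem IsMatching.exists_perfectlyMatched [G.Loopless] {M : Set β} (hfin : M.Finite)
    (hM : G.IsMatching M) :
    ∃ X : Finset α, PerfectlyMatched G.Adj X ∧ (∀ x, x ∈ X ↔ ∃ e ∈ M, G.Inc e x) ∧
      2 * M.ncard = #X := by
  classical
  induction M, hfin using Set.Finite.induction_on with
  | empty => exact ⟨∅, .empty, by simp, by simp⟩
  | @insert e M heM hfin ih =>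
    obtain ⟨X, hX, hcov, hcard⟩ := ih ⟨(Set.subset_insert _ _).trans hM.1, fun f hf f' hf' =>
      hM.2 f (Or.inr hf) f' (Or.inr hf')⟩
    obtain ⟨a, b, he⟩ := exists_isLink_of_mem_edgeSet (hM.1 (Or.inl rfl))
    have hnot : ∀ x, G.Inc e x → x ∉ X := by
      intro x hex hx
      obtain ⟨f, hf, hfx⟩ := (hcov x).1 hx
      exact hM.2 e (Or.inl rfl) f (Or.inr hf) (by rintro rfl; exact heM hf) x ⟨hex, hfx⟩
    have ha := hnot a he.inc_left
    have hb := hnot b he.inc_right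
    refine ⟨insert a (insert b X), ?_, ?_, ?_⟩
    · convert PerfectlyMatched.insert_pair hX ha hb he.ne he.adj
    · intro x
      have hd : ∀ x, G.Inc e x ↔ x = a ∨ x = b := fun x =>
        ⟨fun hx => hx.eq_or_eq_of_isLink he, by
          rintro (rfl | rfl)
          exacts [he.inc_left, he.inc_right]⟩
      simp [hd, hcov, or_assoc]
    · rw [Set.ncard_insert_of_notMem heM hfin, mul_add, hcard,
        card_insert_of_notMem (by simp [ha, he.ne]), card_insert_of_notMem hb]

/-! ### Edges joining a part to the separating set -/

section Boundary

variable {W S : Finset α} {P : Finset (Finset α)} {E : Finset β} {k : ℕ}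

open scoped Classical in
/-- The edges of `E` joining `p` to `S`. -/
noncomputable def joining (G : Graph α β) (E : Finset β) (S p : Finset α) : Finset β :=
  {e ∈ E | ∃ x ∈ p, ∃ a ∈ S, G.IsLink e x a}

theorem mem_joining (hE : ∀ e, e ∈ E ↔ e ∈ G.edgeSet) {p : Finset α} {e : β} :
    e ∈ G.joining E S p ↔ ∃ x ∈ p, ∃ a ∈ S, G.IsLink e x a := by
  classical
  simp only [joining, mem_filter, and_iff_right_iff_imp]
  rintro ⟨x, -, a, -, h⟩
  exact (hE e).2 h.edge_mem

-- The sets of joining edges of different parts are disjoint, and each such edge uses one of the at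
-- most `k` places at a vertex of `S` adjacent to a part in `u`.
open scoped Classical in
theorem sum_card_joining_le (h : IsOddSeparation G.Adj W S P)
    (hE : ∀ e, e ∈ E ↔ e ∈ G.edgeSet) (hdeg : ∀ x ∈ W, #{e ∈ E | G.Inc e x} = k)
    {u : Finset (Finset α)} (hu : u ⊆ P) :
    ∑ p ∈ u, #(G.joining E S p) ≤ k * #{a ∈ S | ∃ p ∈ u, ∃ x ∈ p, G.Adj a x} := by
  rw [← card_biUnion]
  · have h1 : u.biUnion (G.joining E S) ⊆
        ({a ∈ S | ∃ p ∈ u, ∃ x ∈ p, G.Adj a x}).biUnion (fun a => {e ∈ E | G.Inc e a}) := by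
      intro e he
      rw [mem_biUnion] at he
      obtain ⟨p, hp, hep⟩ := he
      obtain ⟨x, hx, a, ha, hxa⟩ := (mem_joining hE).1 hep
      simp only [mem_biUnion, mem_filter]
      exact ⟨a, ⟨ha, p, hp, x, hx, hxa.adj.symm⟩, (hE e).2 hxa.edge_mem, hxa.inc_right⟩
    refine (card_le_card h1).trans (card_biUnion_le.trans ?_)
    rw [sum_congr rfl (fun a ha => hdeg a (h.sep_subset (mem_filter.1 ha).1)), sum_const,
      smul_eq_mul, mul_comm]
  · intro p hp q hq hpq
    rw [Function.onFun, Finset.disjoint_left]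
    intro e he he'
    obtain ⟨x, hx, a, ha, hxa⟩ := (mem_joining hE).1 he
    obtain ⟨y, hy, b, hb, hyb⟩ := (mem_joining hE).1 he'
    rcases hxa.left_eq_or_eq hyb with rfl | rfl
    · exact hpq (h.eq_of_mem p (hu hp) q (hu hq) x hx hy)
    · exact h.notMem_sep p (hu hp) _ hx hb

/-- Handshake parity for a part of an odd separation. -/
theorem odd_card_joining_iff [G.Loopless] (h : IsOddSeparation G.Adj W S P)
    (hW : ∀ x, x ∈ W ↔ x ∈ G.vertexSet) (hE : ∀ e, e ∈ E ↔ e ∈ G.edgeSet)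
    (hdeg : ∀ x ∈ W, (G.incidenceSet x).ncard = k) {p : Finset α} (hp : p ∈ P) :
    Odd #(G.joining E S p) ↔ Odd k := by
  classical
  have hdeg' : ∀ x ∈ p, #{e ∈ E | G.Inc e x} = k := by
    intro x hx
    rw [← hdeg x (h.part_subset p hp hx), ← Set.ncard_coe_finset]
    congr 1
    ext e
    simp only [coe_filter, Set.mem_ofPred_eq, mem_incidenceSet, and_iff_right_iff_imp]
    exact fun he => (hE e).2 he.edge_mem
  have h1 := sum_card_bipartiteAbove_eq_sum_card_bipartiteBelow (s := p) (t := E)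
    (fun x e => G.Inc e x)
  simp only [bipartiteAbove, bipartiteBelow] at h1
  rw [sum_congr rfl hdeg', sum_const, smul_eq_mul] at h1
  -- In the double count of incidences, an edge contributes an odd number exactly when it has one
  -- end in `p`; closedness forces its other end into `S`.
  have h2 : ({e ∈ E | Odd #{x ∈ p | G.Inc e x}} : Finset β) = G.joining E S p := by
    rw [joining]
    refine filter_congr fun e he => ?_
    obtain ⟨u, v, huv⟩ := exists_isLink_of_mem_edgeSet ((hE e).1 he)
    have h3 : ({x ∈ p | G.Inc e x} : Finset α) = ({u, v} : Finset α).filter (· ∈ p) := by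
      ext x
      simp only [mem_filter, mem_insert, mem_singleton, and_comm (a := x ∈ p)]
      refine and_congr_left fun _ => ⟨fun hx => hx.eq_or_eq_of_isLink huv, ?_⟩
      rintro (rfl | rfl)
      exacts [huv.inc_left, huv.inc_right]
    have h4 : (∃ x ∈ p, ∃ a ∈ S, G.IsLink e x a) ↔ (u ∈ p ∧ v ∉ p) ∨ (v ∈ p ∧ u ∉ p) := by
      constructor
      · rintro ⟨x, hx, a, ha, hxa⟩
        have hap : a ∉ p := fun hap => h.notMem_sep p hp a hap ha
        rcases hxa.eq_and_eq_or_eq_and_eq huv with ⟨rfl, rfl⟩ | ⟨rfl, rfl⟩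
        · exact Or.inl ⟨hx, hap⟩
        · exact Or.inr ⟨hx, hap⟩
      · rintro (⟨hu, hv⟩ | ⟨hv, hu⟩)
        · refine ⟨u, hu, v, ?_, huv⟩
          by_contra hvS
          exact hv (h.closed p hp u hu v ((hW v).2 huv.right_mem) hvS huv.adj)
        · refine ⟨v, hv, u, ?_, huv.symm⟩
          by_contra huS
          exact hu (h.closed p hp v hv u ((hW u).2 huv.left_mem) huS huv.adj.symm)
    rw [h3, h4, filter_insert, filter_singleton]
    by_cases hu : u ∈ p <;> by_cases hv : v ∈ p <;> simp [hu, hv, huv.ne]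
  have h3 := odd_sum_iff_odd_card_odd (s := E) (fun e => #{x ∈ p | G.Inc e x})
  rw [h2, ← h1, Nat.odd_mul] at h3
  rw [← h3]
  exact and_iff_right (h.odd_card p hp)

/-- The possible ways in which a part of an odd separation of a `4`- or `5`-regular graph is joined
to `S`. -/
theorem part_trichotomy [G.Loopless] (h : IsOddSeparation G.Adj W S P)
    (hW : ∀ x, x ∈ W ↔ x ∈ G.vertexSet) (hE : ∀ e, e ∈ E ↔ e ∈ G.edgeSet)
    (hdeg : ∀ x ∈ W, (G.incidenceSet x).ncard = k) (hk : k = 4 ∨ k = 5)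
    {p : Finset α} (hp : p ∈ P) :
    (∃ x ∈ p, ∀ a ∈ S, ¬ G.Adj a x) ∨ k ≤ #(G.joining E S p) ∨
      (k ≤ 2 * #(G.joining E S p) ∧
        ∀ x ∈ p, ∀ a ∈ S, ∀ b ∈ S, G.Adj a x → G.Adj b x → a = b) := by
  classical
  rw [or_iff_not_imp_left, or_iff_not_imp_left]
  intro hbad hlt
  push Not at hbad hlt
  have hex : ∀ x ∈ p, ∃ e, ∃ a ∈ S, G.IsLink e x a := by
    intro x hx
    obtain ⟨a, ha, e, he⟩ := hbad x hx
    exact ⟨e, a, ha, he.symm⟩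
  have hpS : ∀ x ∈ p, x ∉ S := h.notMem_sep p hp
  have hodd := h.odd_card p hp
  have huniq : ∀ e, ∀ x ∈ p, ∀ a ∈ S, ∀ y ∈ p, ∀ b ∈ S, G.IsLink e x a → G.IsLink e y b →
      x = y ∧ a = b := by
    intro e x hx a ha y hy b hb hxa hyb
    rcases hxa.eq_and_eq_or_eq_and_eq hyb with h | ⟨rfl, rfl⟩
    · exact h
    · exact absurd hb (hpS _ hx)
  obtain ⟨x₀, hx₀⟩ := card_pos.1 hodd.pos
  have : Nonempty β := ⟨(hex x₀ hx₀).choose⟩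
  -- One edge to `S` is chosen at each vertex of `p`; these edges are distinct, so `#p` is at most
  -- the number of joining edges.
  choose! ε a ha hε using hex
  have hinj : Set.InjOn ε p := by
    intro x hx y hy hxy
    have := hε x hx
    rw [hxy] at this
    exact (huniq _ x hx _ (ha x hx) y hy _ (ha y hy) this (hε y hy)).1
  have hsub : p.image ε ⊆ G.joining E S p :=
    image_subset_iff.2 fun x hx => (mem_joining hE).2 ⟨x, hx, a x, ha x hx, hε x hx⟩
  have hcard := card_le_card hsub
  rw [card_image_of_injOn hinj] at hcard
  -- All `k` edges at the vertex of a singleton part go to `S`, against `hlt`.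
  have hone : #p ≠ 1 := by
    intro h1
    obtain ⟨x, rfl⟩ := card_eq_one.1 h1
    have hxW := h.part_subset _ hp (mem_singleton_self x)
    have h2 : G.incidenceSet x ⊆ G.joining E S {x} := by
      intro e he
      obtain ⟨y, hxy⟩ := (mem_incidenceSet x e).1 he
      refine (mem_joining hE).2 ⟨x, mem_singleton_self x, y, ?_, hxy⟩
      by_contra hyS
      have := h.closed _ hp x (mem_singleton_self x) y ((hW y).2 hxy.right_mem) hyS hxy.adj
      exact hxy.ne (mem_singleton.1 this).symm
    have h3 := Set.ncard_le_ncard h2 (finite_toSet _)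
    rw [hdeg x hxW, Set.ncard_coe_finset] at h3
    omega
  have hpar := odd_card_joining_iff h hW hE hdeg hp
  -- Now `3 ≤ #p ≤ m < k ≤ 5`, where `m` counts the joining edges and has the parity of `k`. This
  -- excludes `k = 4` and forces `m = 3` when `k = 5`.
  have hthree : k = 5 ∧ #p = 3 ∧ #(G.joining E S p) = 3 := by
    generalize #(G.joining E S p) = m at *
    generalize #p = n at *
    rw [Nat.odd_iff] at hodd
    rw [Nat.odd_iff, Nat.odd_iff] at hpar
    omega
  refine ⟨by omega, ?_⟩
  -- Equal cardinalities leave no joining edges beyond the chosen ones, so each vertex of `p` has a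
  -- single edge to `S`.
  have himg : p.image ε = G.joining E S p :=
    eq_of_subset_of_card_le hsub (by rw [card_image_of_injOn hinj]; omega)
  have hnbr : ∀ x ∈ p, ∀ b ∈ S, G.Adj b x → b = a x := by
    rintro x hx b hb ⟨e, he⟩
    have hej : e ∈ G.joining E S p := (mem_joining hE).2 ⟨x, hx, b, hb, he.symm⟩
    rw [← himg, mem_image] at hej
    obtain ⟨y, hy, rfl⟩ := hej
    obtain ⟨rfl, h2⟩ := huniq _ x hx b hb y hy _ (ha y hy) he.symm (hε y hy)
    exact h2
  intro x hx b hb b' hb' hbx hbx'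
  rw [hnbr x hx b hb hbx, hnbr x hx b' hb' hbx']

end Boundary

end Graph

theorem theorem2 {α β : Type*} (G : Graph α β) (hfin : G.vertexSet.Finite) (hloop : G.Loopless)
    (k : ℕ) (hk : k = 4 ∨ k = 5) (hreg : G.IsRegular k) :
    ∃ M : Set β, G.IsMaximumMatching M ∧
      ∀ x y : α, G.IsUnsaturated M x → G.IsUnsaturated M y → x ≠ y →
        ¬ ∃ z : α, G.Adj x z ∧ G.Adj y z := by
  classical
  have hEfin := hreg.finite_edgeSet hfin
  have hW : ∀ x, x ∈ hfin.toFinset ↔ x ∈ G.vertexSet := fun x => hfin.mem_toFinset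
  have hE : ∀ e, e ∈ hEfin.toFinset ↔ e ∈ G.edgeSet := fun e => hEfin.mem_toFinset
  have hdeg : ∀ x ∈ hfin.toFinset, (G.incidenceSet x).ncard = k := by
    intro x hx
    rw [Set.ncard, hreg.incidenceSet_encard ((hW x).1 hx), ENat.toNat_natCast]
  have hsymm : ∀ x y, G.Adj x y → G.Adj y x := fun _ _ h => h.symm
  obtain ⟨S, P, h⟩ := exists_isGallaiPartition hsymm hfin.toFinset
  obtain ⟨X, hXW, hX, hmax, hcommon⟩ := h.exists_perfectlyMatched hsymm
    (fun x y hxy => (hW x).2 hxy.left_mem) (k := k) (by omega)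
    (fun p => #(G.joining hEfin.toFinset S p))
    (fun u hu => G.sum_card_joining_le h.toIsOddSeparation hE (fun x hx => by
      rw [← hdeg x hx, ← Set.ncard_coe_finset]
      congr 1
      ext e
      simp only [coe_filter, Set.mem_ofPred_eq, Graph.mem_incidenceSet, and_iff_right_iff_imp]
      exact fun he => (hE e).2 he.edge_mem) hu)
    (fun p hp => Graph.part_trichotomy h.toIsOddSeparation hW hE hdeg hk hp)
  obtain ⟨M, hMfin, hM, hcov, hcard⟩ := Graph.exists_isMatching_of_perfectlyMatched hX
  refine ⟨M, ⟨hM, fun M' hM' => ?_⟩, fun x y hx hy hxy => ?_⟩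
  · have hM'fin := hEfin.subset hM'.1
    obtain ⟨Y, hY, hcov', hcard'⟩ := hM'.exists_perfectlyMatched hM'fin
    have := hmax Y (fun x hx => by
      obtain ⟨e, -, he⟩ := (hcov' x).1 hx
      exact (hW x).2 he.vertex_mem) hY
    rw [← hM'fin.cast_ncard_eq, ← hMfin.cast_ncard_eq, Nat.cast_le]
    omega
  · have hout : ∀ x, G.IsUnsaturated M x → x ∉ X := fun x hx hxX => by
      obtain ⟨e, he, hex⟩ := (hcov x).1 hxX
      exact hx.2 e he hex
    rintro ⟨z, hxz, hyz⟩
    exact hcommon x ((hW x).2 hx.1) (hout x hx) y ((hW y).2 hy.1) (hout y hy) hxy z hxz hyz
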